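/- For a finite simple graph $X$ with vertex set $V$ and adjacency matrix $A$, let $C(\mathrm{Qut}(X))$ be the universal unital $C^*$-algebra generated by elements $u_{xy}$ ($x,y\in V$) subject to the relations that $U=(u_{xy})_{x,y\in V}$ is a magic unitary, i.e. $u_{xy}=u_{xy}^*=u_{xy}^2$ and $\sum_{y'}u_{xy'}=1=\sum_{x'}u_{x'y}$ for all $x,y\in V$, and that $AU=UA$. The quantum automorphism group $\mathrm{Qut}(X)$ of $X$ is the compact quantum group given by this $C^*$-algebra with comultiplication $u_{xz}\mapsto\sum_{y\in V}u_{xy}\otimes u_{yz}$. It is called trivial if it is the one-element group, i.e. if $C(\mathrm{Qut}(X))\cong\mathbb{C}$. Theorem. Let $X_n$ be a graph chosen uniformly at random among all simple graphs with vertex set $\{0,1,\dots,n-1\}$. Then $$\lim_{n\to\infty}\Pr\bigl[\mathrm{Qut}(X_n)\text{ is nontrivial}\bigr]=0 .$$ -/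

import Mathlib

open Filter Topology
open scoped ENNReal

universe u

noncomputable section

/-- A square matrix with entries in a unital C*-algebra is a *magic unitary* if every entry is a
projection (`p = p* = p²`) and every row and every column sums to `1`. -/
structure IsMagicUnitary {V : Type*} [Fintype V] {A : Type*} [CStarAlgebra A]
    (U : Matrix V V A) : Prop where
  isStarProjection : ∀ x y, IsStarProjection (U x y)
  row_sum : ∀ x, ∑ y, U x y = 1
  col_sum : ∀ y, ∑ x, U x y = 1

open scoped Classical in
/-- A *quantum symmetry model* of a finite graph `G`: a nontrivial unital C*-algebra together with
a magic unitary, indexed by the vertices, that commutes with the adjacency matrix of `G`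
(the scalar matrix is regarded as a matrix over the C*-algebra). -/
structure QutModel {V : Type*} [Fintype V] (G : SimpleGraph V) where
  carrier : Type u
  [instCStarAlgebra : CStarAlgebra carrier]
  [instNontrivial : Nontrivial carrier]
  mat : Matrix V V carrier
  isMagicUnitary : IsMagicUnitary mat
  comm : (G.adjMatrix ℂ).map (algebraMap ℂ carrier) * mat =
    mat * (G.adjMatrix ℂ).map (algebraMap ℂ carrier)

namespace QutModel

attribute [instance] QutModel.instCStarAlgebra QutModel.instNontrivial

variable {V : Type*} [Fintype V] (G : SimpleGraph V)

/-- The ℓ^∞-product, over all models of `G`, of the C*-algebras of the models: bounded families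
with the supremum norm and pointwise operations. -/
abbrev Product : Type _ := lp (fun M : QutModel.{u} G => M.carrier) ∞

instance : CStarAlgebra (Product.{u} G) where

/-- The canonical generator `u_{xy}`: the family of all the `(x, y)`-entries of the models. -/
def gen (x y : V) : Product.{u} G :=
  ⟨fun M => M.mat x y, memℓp_infty ⟨1, by
    rintro _ ⟨M, rfl⟩
    exact (M.isMagicUnitary.isStarProjection x y).norm_le⟩⟩

end QutModel

/-- The quantum symmetry algebra `C(Qut(G))` of a finite graph `G`: the universal C*-algebra
generated by elements `u_{xy}` (`x`, `y` vertices) subject to the relations that `(u_{xy})` is a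
magic unitary commuting with the adjacency matrix of `G`. As usual it is realized as the C*-algebra
generated by the direct sum of all the models, so that the norm of a *-polynomial in the generators
is the supremum of its norms in the models.

The universe `u` is the one in which the models live. It is immaterial, because any model can be
cut down to the separable C*-algebra generated by its entries, which has a copy in `Type u`. -/
def QuantumSymmetryAlgebra {V : Type*} [Fintype V] (G : SimpleGraph V) :
    StarSubalgebra ℂ (QutModel.Product.{u} G) :=
  (StarAlgebra.adjoin ℂ
    (Set.range fun p : V × V => QutModel.gen.{u} G p.1 p.2)).topologicalClosure

/-- The quantum automorphism group `Qut(G)` is *trivial* if it is the one-element group, that is,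
if `C(Qut(G))` is *-isomorphic to `ℂ`, the algebra of functions on the one-element group.
(The comultiplication imposes nothing more: the only unital *-homomorphism from `ℂ` to
`ℂ ⊗ ℂ = ℂ` is the identity.) -/
def HasTrivialQut {V : Type*} [Fintype V] (G : SimpleGraph V) : Prop :=
  Nonempty (QuantumSymmetryAlgebra.{u} G ≃⋆ₐ[ℂ] ℂ)

end

/-! Because $U$ commutes with $A$, the vectors fixed by $U$ are stable under $A$, and $v$ is fixed
exactly when $u_{xy}=0$ whenever $v_x\ne v_y$. Starting from the constant vector, then from the
indicators of the degree classes, two rounds of colour refinement force $u_{xy}=0$ unless $x,y$ are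
degree twins. Without twins $U$ is the identity and the algebra is $\mathbb{C}$
(`hasTrivialQut_of_no_degreeTwins`).

It remains to see that twins are rare. Fix $x\ne y$ and choose one splitter of each occurring
degree. Exchanging the roles of $x$ and $y$ on a set of chosen splitters keeps all degrees outside
$\{x,y\}$, and at most one of the resulting graphs has $x,y$ as twins. With at least $k$ chosen
splitters the probability is thus at most $2^{-k}$ (`two_pow_mul_card_degreeTwins_le`).

Splitters of few degrees are excluded in two ways. Fewer than $s$ splitters is exponentially
unlikely. Otherwise, Cauchy–Schwarz makes fewer than $k$ degrees imply at least $s^2/k$ pairs of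
equal degree, while the expected number of such pairs is $O(n^{3/2})$. Taking $s\approx n/10$ and
$k\approx n^{1/4}$, a union bound over pairs and Markov's inequality finish the proof. -/

noncomputable section

/-! ### Magic unitaries and colour refinement -/

namespace IsMagicUnitary

variable {V : Type*} [Fintype V] {A : Type*} [CStarAlgebra A] {U : Matrix V V A}

open scoped CStarAlgebra in
-- Compressing the row sum by the projection `U x z` leaves a zero sum of positive elements over the
-- indices other than `z`, so each of them vanishes.
theorem mul_eq_zero_of_ne (hU : IsMagicUnitary U) (x : V) {y z : V} (hyz : y ≠ z) :
    U x y * U x z = 0 := by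
  classical
  let _ : PartialOrder A := CStarAlgebra.spectralOrder A
  have _ : StarOrderedRing A := CStarAlgebra.spectralOrderedRing A
  have hsa (y : V) : star (U x y) = U x y := (hU.isStarProjection x y).isSelfAdjoint
  have hid (y : V) : U x y * U x y = U x y := (hU.isStarProjection x y).isIdempotentElem
  have hsq (i : V) : star (U x i * U x z) * (U x i * U x z) = U x z * U x i * U x z := by
    rw [star_mul, hsa, hsa, mul_assoc, ← mul_assoc (U x i) (U x i), hid, mul_assoc]
  have hsum : ∑ i, U x z * U x i * U x z = U x z := by
    rw [← Finset.sum_mul, ← Finset.mul_sum, hU.row_sum, mul_one, hid]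
  have hzero : ∑ i ∈ Finset.univ.erase z, U x z * U x i * U x z = 0 := by
    rw [← Finset.add_sum_erase _ _ (Finset.mem_univ z), hid, hid] at hsum
    exact left_eq_add.mp hsum.symm
  have hnonneg (i : V) (_ : i ∈ Finset.univ.erase z) : 0 ≤ U x z * U x i * U x z := by
    rw [← hsq i]
    exact star_mul_self_nonneg _
  have hy := (Finset.sum_eq_zero_iff_of_nonneg hnonneg).mp hzero y (by simp [hyz])
  rw [← hsq y] at hy
  exact (CStarRing.star_mul_self_eq_zero_iff _).mp hy

/-- A vector is fixed by a magic unitary iff the entries linking different values vanish. -/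
theorem sum_smul_eq_iff (hU : IsMagicUnitary U) (v : V → ℂ) :
    (∀ x, ∑ y, v y • U x y = v x • (1 : A)) ↔ ∀ x y, v x ≠ v y → U x y = 0 := by
  classical
  constructor
  · intro h x y hxy
    -- Orthogonality within a row leaves only the term of index `y` after multiplication by `U x y`.
    have hy := congrArg (· * U x y) (h x)
    simp only [Finset.sum_mul, smul_mul_assoc, one_mul] at hy
    rw [Finset.sum_eq_single y, (hU.isStarProjection x y).isIdempotentElem.eq] at hy
    · have : (v y - v x) • U x y = 0 := by rw [sub_smul, hy, sub_self]
      exact (smul_eq_zero.mp this).resolve_left (sub_ne_zero.mpr hxy.symm)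
    · intro z _ hz
      rw [hU.mul_eq_zero_of_ne x hz, smul_zero]
    · simp
  · intro h x
    rw [← hU.row_sum x, Finset.smul_sum]
    refine Finset.sum_congr rfl fun y _ => ?_
    by_cases hxy : v x = v y
    · rw [hxy]
    · rw [h x y hxy, smul_zero, smul_zero]

theorem apply_self_eq_one (hU : IsMagicUnitary U) (h : ∀ x y, x ≠ y → U x y = 0) (x : V) :
    U x x = 1 := by
  classical
  rw [← hU.row_sum x, Finset.sum_eq_single x]
  · exact fun y _ hy => h x y hy.symm
  · simp

end IsMagicUnitary

namespace SimpleGraph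

variable {V : Type*} [Fintype V]

open scoped Classical in
/-- The number of neighbours of `x` having degree `d`. -/
def degreeCount (G : SimpleGraph V) (x : V) (d : ℕ) : ℕ :=
  Finset.card {w | G.Adj x w ∧ G.degree w = d}

open scoped Classical in
/-- Two vertices are degree twins if they have the same degree, and their neighbours have the same
degrees counted with multiplicity: two rounds of colour refinement do not tell them apart. -/
def DegreeTwins (G : SimpleGraph V) (x y : V) : Prop :=
  G.degree x = G.degree y ∧ ∀ d, G.degreeCount x d = G.degreeCount y d

end SimpleGraph

namespace QutModel

variable {V : Type*} [Fintype V] {G : SimpleGraph V}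

open scoped Classical in
-- One round of colour refinement: commutation makes the adjacency matrix preserve the vectors fixed
-- by the magic unitary.
theorem mat_eq_zero_adjMatrix_mulVec (M : QutModel.{u} G) (v : V → ℂ)
    (hv : ∀ x y, v x ≠ v y → M.mat x y = 0) (x y : V)
    (hxy : ((G.adjMatrix ℂ).mulVec v) x ≠ ((G.adjMatrix ℂ).mulVec v) y) : M.mat x y = 0 := by
  refine (M.isMagicUnitary.sum_smul_eq_iff ((G.adjMatrix ℂ).mulVec v)).mp (fun x => ?_) x y hxy
  have hv' := (M.isMagicUnitary.sum_smul_eq_iff v).mpr hv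
  have hcomm (z : V) : ∑ y, (G.adjMatrix ℂ) x y • M.mat y z
      = ∑ y, (G.adjMatrix ℂ) y z • M.mat x y := by
    have h := congrFun (congrFun M.comm x) z
    simp only [Matrix.mul_apply, Matrix.map_apply] at h
    simpa only [Algebra.smul_def, Algebra.commutes] using h
  calc ∑ y, ((G.adjMatrix ℂ).mulVec v) y • M.mat x y
      = ∑ y, ∑ z, v z • (G.adjMatrix ℂ) y z • M.mat x y := by
        simp only [Matrix.mulVec, dotProduct, Finset.sum_smul, smul_smul]
        simp only [mul_comm]
    _ = ∑ z, v z • ∑ y, (G.adjMatrix ℂ) x y • M.mat y z := by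
        rw [Finset.sum_comm]
        simp only [hcomm, Finset.smul_sum]
    _ = ∑ y, (G.adjMatrix ℂ) x y • ∑ z, v z • M.mat y z := by
        simp only [Finset.smul_sum]
        rw [Finset.sum_comm]
        simp only [smul_smul, mul_comm]
    _ = ((G.adjMatrix ℂ).mulVec v) x • (1 : M.carrier) := by
        simp only [hv', Matrix.mulVec, dotProduct, Finset.sum_smul, smul_smul]

open scoped Classical in
theorem mat_eq_zero_of_degree_ne (M : QutModel.{u} G) {x y : V}
    (hxy : G.degree x ≠ G.degree y) : M.mat x y = 0 := by
  refine M.mat_eq_zero_adjMatrix_mulVec (Function.const _ 1) (by simp) x y ?_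
  simpa using hxy

open scoped Classical in
theorem mat_eq_zero_of_not_degreeTwins (M : QutModel.{u} G) {x y : V}
    (hxy : ¬ G.DegreeTwins x y) : M.mat x y = 0 := by
  by_cases hdeg : G.degree x = G.degree y
  · obtain ⟨d, hd⟩ : ∃ d, G.degreeCount x d ≠ G.degreeCount y d := by
      by_contra! h
      exact hxy ⟨hdeg, h⟩
    have hcount (x : V) : ((G.adjMatrix ℂ).mulVec fun w => if G.degree w = d then 1 else 0) x
        = G.degreeCount x d := by
      simp only [Matrix.mulVec, dotProduct, SimpleGraph.adjMatrix_apply, SimpleGraph.degreeCount,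
        Finset.card_filter, Nat.cast_sum]
      exact Finset.sum_congr rfl fun w _ => by by_cases h : G.Adj x w <;> simp [h]
    refine M.mat_eq_zero_adjMatrix_mulVec (fun w => if G.degree w = d then 1 else 0) ?_ x y ?_
    · intro z w hzw
      exact M.mat_eq_zero_of_degree_ne fun h => hzw (by simp only [h])
    · rw [hcount, hcount]
      exact_mod_cast hd
  · exact M.mat_eq_zero_of_degree_ne hdeg

open scoped Classical in
/-- The identity matrix as a quantum symmetry. -/
def identity (G : SimpleGraph V) : QutModel.{u} G where
  -- Functions on one point give a copy of `ℂ` in `Type u`.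
  carrier := PUnit.{u + 1} → ℂ
  mat := 1
  isMagicUnitary :=
    { isStarProjection := fun x y => by
        by_cases h : x = y
        · subst h
          rw [Matrix.one_apply_eq]
          exact .one _
        · rw [Matrix.one_apply_ne h]
          exact .zero _
      row_sum := fun x => by simp [Matrix.one_apply]
      col_sum := fun y => by simp [Matrix.one_apply] }
  comm := by rw [Matrix.one_mul, Matrix.mul_one]

/-- Some model has to exist for the scalars to embed in the product. -/
instance nontrivial_product (G : SimpleGraph V) : Nontrivial (Product.{u} G) := by
  refine ⟨0, 1, fun h => ?_⟩
  have h' := congrArg (fun f : Product.{u} G => f (identity G)) h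
  exact zero_ne_one (α := (identity G).carrier) h'

end QutModel

theorem hasTrivialQut_of_no_degreeTwins {V : Type*} [Fintype V] (G : SimpleGraph V)
    (h : ∀ x y, x ≠ y → ¬ G.DegreeTwins x y) : HasTrivialQut.{u} G := by
  have hzero (M : QutModel.{u} G) (x y : V) (hxy : x ≠ y) : M.mat x y = 0 :=
    M.mat_eq_zero_of_not_degreeTwins (h x y hxy)
  have hgen (x y : V) : QutModel.gen.{u} G x y ∈ (⊥ : StarSubalgebra ℂ (QutModel.Product.{u} G)) := by
    by_cases hxy : x = y
    · subst hxy
      convert one_mem (⊥ : StarSubalgebra ℂ (QutModel.Product.{u} G))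
      ext M
      exact M.isMagicUnitary.apply_self_eq_one (hzero M) x
    · convert zero_mem (⊥ : StarSubalgebra ℂ (QutModel.Product.{u} G))
      ext M
      exact hzero M x y hxy
  have hadjoin : StarAlgebra.adjoin ℂ (Set.range fun p : V × V => QutModel.gen.{u} G p.1 p.2) = ⊥ := by
    rw [eq_bot_iff, StarAlgebra.adjoin_le_iff]
    rintro _ ⟨p, rfl⟩
    exact hgen p.1 p.2
  have hbot : QuantumSymmetryAlgebra.{u} G = ⊥ := by
    rw [QuantumSymmetryAlgebra, hadjoin, eq_bot_iff]
    refine StarSubalgebra.topologicalClosure_minimal le_rfl ?_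
    -- The scalars are finite-dimensional, hence closed, so taking the closure adds nothing.
    have : ((⊥ : StarSubalgebra ℂ (QutModel.Product.{u} G)) : Set (QutModel.Product.{u} G))
        = ((1 : Submodule ℂ (QutModel.Product.{u} G)) : Set (QutModel.Product.{u} G)) := by
      ext f
      rw [SetLike.mem_coe, StarSubalgebra.mem_bot, SetLike.mem_coe, Submodule.mem_one]
      rfl
    rw [this, Submodule.one_eq_span]
    exact Submodule.closed_of_finiteDimensional _
  rw [HasTrivialQut, hbot]
  refine ⟨(StarAlgEquiv.ofBijective
    (StarAlgHom.ofId ℂ (⊥ : StarSubalgebra ℂ (QutModel.Product.{u} G))) ⟨?_, ?_⟩).symm⟩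
  · intro a b hab
    exact (algebraMap ℂ (QutModel.Product.{u} G)).injective (congrArg Subtype.val hab)
  · rintro ⟨f, hf⟩
    obtain ⟨a, rfl⟩ := StarSubalgebra.mem_bot.mp hf
    exact ⟨a, rfl⟩

end

/-! ### Switching at splitters -/

namespace SimpleGraph

noncomputable section

open scoped Classical symmDiff

variable {V : Type*}

theorem symmDiff_adj (G H : SimpleGraph V) (a b : V) :
    (G ∆ H).Adj a b ↔ (G.Adj a b ↔ ¬ H.Adj a b) := by
  rw [symmDiff, sup_adj, sdiff_adj, sdiff_adj]
  tauto

/-- The graph in which `x` is joined to the elements of `X`, and `y` to those of `Y`. -/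
def twoStar (x y : V) (X Y : Finset V) : SimpleGraph V :=
  fromRel fun a b => a = x ∧ b ∈ X ∨ a = y ∧ b ∈ Y

theorem twoStar_symmDiff {x y : V} {X Y X' Y' : Finset V} (hx : x ≠ y)
    (hX : x ∉ X ∧ y ∉ X) (hY : x ∉ Y ∧ y ∉ Y) (hX' : x ∉ X' ∧ y ∉ X') (hY' : x ∉ Y' ∧ y ∉ Y') :
    twoStar x y X Y ∆ twoStar x y X' Y' = twoStar x y (X ∆ X') (Y ∆ Y') := by
  ext a b
  simp only [symmDiff_adj, twoStar, fromRel_adj, Finset.mem_symmDiff]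
  by_cases ha : a = x <;> by_cases ha' : a = y <;> by_cases hb : b = x <;> by_cases hb' : b = y <;>
    grind

variable [Fintype V]

/-- The neighbours of `x` other than `y`. -/
def outerNeighbors (G : SimpleGraph V) (x y : V) : Finset V :=
  {w | w ≠ x ∧ w ≠ y ∧ G.Adj x w}

/-- The vertices other than `x` and `y` that are adjacent to exactly one of them. -/
def splitters (G : SimpleGraph V) (x y : V) : Finset V :=
  G.outerNeighbors x y ∆ G.outerNeighbors y x

theorem mem_outerNeighbors {G : SimpleGraph V} {x y w : V} :
    w ∈ G.outerNeighbors x y ↔ w ≠ x ∧ w ≠ y ∧ G.Adj x w := by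
  simp [outerNeighbors]

theorem notMem_outerNeighbors (G : SimpleGraph V) (x y : V) :
    x ∉ G.outerNeighbors x y ∧ y ∉ G.outerNeighbors x y := by
  simp [mem_outerNeighbors]

theorem notMem_splitters (G : SimpleGraph V) (x y : V) :
    x ∉ G.splitters x y ∧ y ∉ G.splitters x y := by
  simp [splitters, Finset.mem_symmDiff, mem_outerNeighbors]

theorem outerNeighbors_symmDiff_twoStar_left (G : SimpleGraph V) {x y : V} {X Y : Finset V}
    (hxy : x ≠ y) (hX : x ∉ X ∧ y ∉ X) (hY : x ∉ Y ∧ y ∉ Y) :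
    (G ∆ twoStar x y X Y).outerNeighbors x y = G.outerNeighbors x y ∆ X := by
  ext w
  simp only [mem_outerNeighbors, Finset.mem_symmDiff, symmDiff_adj, twoStar, fromRel_adj]
  grind

theorem outerNeighbors_symmDiff_twoStar_right (G : SimpleGraph V) {x y : V} {X Y : Finset V}
    (hxy : x ≠ y) (hX : x ∉ X ∧ y ∉ X) (hY : x ∉ Y ∧ y ∉ Y) :
    (G ∆ twoStar x y X Y).outerNeighbors y x = G.outerNeighbors y x ∆ Y := by
  ext w
  simp only [mem_outerNeighbors, Finset.mem_symmDiff, symmDiff_adj, twoStar, fromRel_adj]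
  grind

theorem splitters_symmDiff_twoStar (G : SimpleGraph V) {x y : V} {T : Finset V}
    (hxy : x ≠ y) (hT : x ∉ T ∧ y ∉ T) :
    (G ∆ twoStar x y T T).splitters x y = G.splitters x y := by
  rw [splitters, outerNeighbors_symmDiff_twoStar_left G hxy hT hT,
    outerNeighbors_symmDiff_twoStar_right G hxy hT hT, symmDiff_symmDiff_symmDiff_comm,
    symmDiff_self, symmDiff_bot, splitters]

/-- A vertex of `T` is joined to exactly one of `x`, `y`. Toggling both possible edges applies the
transposition of `x` and `y` to its neighbourhood. -/
theorem degree_symmDiff_twoStar (G : SimpleGraph V) {x y w : V} {T : Finset V}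
    (hT : T ⊆ G.splitters x y) (hwx : w ≠ x) (hwy : w ≠ y) :
    (G ∆ twoStar x y T T).degree w = G.degree w := by
  by_cases hw : w ∈ T
  · have hsplit := hT hw
    rw [← card_neighborFinset_eq_degree, ← card_neighborFinset_eq_degree,
      ← Finset.card_map (Equiv.swap x y).toEmbedding]
    congr 1
    ext a
    rw [Finset.mem_map_equiv, Equiv.symm_swap, Equiv.swap_apply_def, mem_neighborFinset,
      mem_neighborFinset, symmDiff_adj]
    simp only [splitters, Finset.mem_symmDiff, mem_outerNeighbors] at hsplit
    have h1 := G.adj_comm w x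
    have h2 := G.adj_comm w y
    simp only [twoStar, fromRel_adj]
    grind
  · rw [← card_neighborFinset_eq_degree, ← card_neighborFinset_eq_degree]
    congr 1
    ext a
    rw [mem_neighborFinset, mem_neighborFinset, symmDiff_adj]
    simp only [twoStar, fromRel_adj]
    grind

theorem degree_eq_card_outerNeighbors (G : SimpleGraph V) (x y : V) :
    G.degree x = (G.outerNeighbors x y).card + if G.Adj x y then 1 else 0 := by
  have h : G.outerNeighbors x y = (G.neighborFinset x).erase y := by
    ext w
    have := G.ne_of_adj (a := x) (b := w)
    simp only [mem_outerNeighbors, Finset.mem_erase, mem_neighborFinset]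
    grind
  rw [h, ← card_neighborFinset_eq_degree]
  split_ifs with hxy
  · rw [Finset.card_erase_add_one (by simpa using hxy)]
  · rw [Finset.erase_eq_of_notMem (by simpa using hxy), add_zero]

theorem degreeCount_eq_card_outerNeighbors (G : SimpleGraph V) (x y : V) (d : ℕ) :
    G.degreeCount x d = ((G.outerNeighbors x y).filter fun w => G.degree w = d).card +
      if G.Adj x y ∧ G.degree y = d then 1 else 0 := by
  have h : ((G.outerNeighbors x y).filter fun w => G.degree w = d)
      = (Finset.univ.filter fun w => G.Adj x w ∧ G.degree w = d).erase y := by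
    ext w
    have := G.ne_of_adj (a := x) (b := w)
    simp only [mem_outerNeighbors, Finset.mem_erase, Finset.mem_filter, Finset.mem_univ, true_and]
    grind
  rw [h, degreeCount]
  split_ifs with hxy
  · rw [Finset.card_erase_add_one (by simpa using hxy)]
  · rw [Finset.erase_eq_of_notMem (by simpa using hxy), add_zero]

/-- A possible edge between the twins contributes to both counts at the same degree, so it cancels.
-/
theorem DegreeTwins.card_outerNeighbors_eq {G : SimpleGraph V} {x y : V} (h : G.DegreeTwins x y)
    (d : ℕ) : ((G.outerNeighbors x y).filter fun w => G.degree w = d).card =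
      ((G.outerNeighbors y x).filter fun w => G.degree w = d).card := by
  have hd := h.2 d
  rw [G.degreeCount_eq_card_outerNeighbors x y, G.degreeCount_eq_card_outerNeighbors y x,
    G.adj_comm y x, h.1] at hd
  exact Nat.add_right_cancel hd

/-- Exchanging the neighbours of degree twins in a nonempty set of splitters of different degrees
destroys the twin property. -/
theorem DegreeTwins.not_symmDiff_twoStar {G : SimpleGraph V} {x y : V} (hxy : x ≠ y)
    (h : G.DegreeTwins x y) {T : Finset V} (hT : T ⊆ G.splitters x y)
    (hinj : Set.InjOn (fun w => G.degree w) T) (hne : T.Nonempty) :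
    ¬ (G ∆ twoStar x y T T).DegreeTwins x y := by
  intro h'
  obtain ⟨v, hv⟩ := hne
  have hTxy : x ∉ T ∧ y ∉ T :=
    ⟨fun hx => (G.notMem_splitters x y).1 (hT hx), fun hy => (G.notMem_splitters x y).2 (hT hy)⟩
  have e := h.card_outerNeighbors_eq (G.degree v)
  have e' := h'.card_outerNeighbors_eq (G.degree v)
  rw [outerNeighbors_symmDiff_twoStar_left G hxy hTxy hTxy,
    outerNeighbors_symmDiff_twoStar_right G hxy hTxy hTxy] at e'
  -- Degrees outside `x`, `y` are unchanged and `v` is the only element of `T` of its degree, so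
  -- only `v` is toggled in this class.
  have key (N : Finset V) (hN : x ∉ N ∧ y ∉ N) :
      ((N ∆ T).filter fun w => (G ∆ twoStar x y T T).degree w = G.degree v)
        = (N.filter fun w => G.degree w = G.degree v) ∆ {v} := by
    ext w
    by_cases hw : w = x ∨ w = y
    · simp only [Finset.mem_symmDiff, Finset.mem_filter, Finset.mem_singleton]
      grind
    · push Not at hw
      have hdeg := G.degree_symmDiff_twoStar hT hw.1 hw.2
      have hvw : w ∈ T → G.degree w = G.degree v → w = v := fun hw' hd => hinj hw' hv hd
      simp only [Finset.mem_symmDiff, Finset.mem_filter, Finset.mem_singleton, hdeg]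
      grind
  rw [key _ (G.notMem_outerNeighbors x y), key _ (G.notMem_outerNeighbors y x).symm] at e'
  have hins (N : Finset V) (hN : v ∉ N) : (N ∆ {v}).card = N.card + 1 := by
    rw [← Finset.card_insert_of_notMem hN]
    congr 1
    ext w
    simp only [Finset.mem_symmDiff, Finset.mem_singleton, Finset.mem_insert]
    grind
  have hera (N : Finset V) (hN : v ∈ N) : (N ∆ {v}).card + 1 = N.card := by
    rw [← Finset.card_erase_add_one hN]
    congr 2
    ext w
    simp only [Finset.mem_symmDiff, Finset.mem_singleton, Finset.mem_erase]
    grind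
  -- One count rises by one and the other drops by one, so counts equal before now differ by two.
  rcases Finset.mem_symmDiff.mp (hT hv) with ⟨h1, h2⟩ | ⟨h1, h2⟩
  · have a1 := hera ((G.outerNeighbors x y).filter fun w => G.degree w = G.degree v) (by simp [h1])
    have a2 := hins ((G.outerNeighbors y x).filter fun w => G.degree w = G.degree v) (by simp [h2])
    lia
  · have a1 := hera ((G.outerNeighbors y x).filter fun w => G.degree w = G.degree v) (by simp [h1])
    have a2 := hins ((G.outerNeighbors x y).filter fun w => G.degree w = G.degree v) (by simp [h2])
    lia

/-- Representatives of the degrees of the splitters. -/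
def degreeReps (G : SimpleGraph V) (x y : V) : Finset V :=
  {w ∈ G.splitters x y | ∀ z ∈ G.splitters x y, G.degree z = G.degree w →
    Fintype.equivFin V w ≤ Fintype.equivFin V z}

theorem degreeReps_subset (G : SimpleGraph V) (x y : V) : G.degreeReps x y ⊆ G.splitters x y :=
  Finset.filter_subset _ _

theorem injOn_degree_degreeReps (G : SimpleGraph V) (x y : V) :
    Set.InjOn (fun w => G.degree w) (G.degreeReps x y) := by
  intro v hv w hw hvw
  simp only [degreeReps, Finset.coe_filter, Set.mem_ofPred_eq] at hv hw
  exact (Fintype.equivFin V).injective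
    (le_antisymm (hv.2 w hw.1 hvw.symm) (hw.2 v hv.1 hvw))

theorem card_image_degree_le (G : SimpleGraph V) (x y : V) :
    ((G.splitters x y).image fun w => G.degree w).card ≤ (G.degreeReps x y).card := by
  refine (Finset.card_le_card fun d hd => ?_).trans
    (Finset.card_image_le (f := fun w => G.degree w))
  obtain ⟨w, hw, rfl⟩ := Finset.mem_image.mp hd
  obtain ⟨z, hz, hmin⟩ := Finset.exists_min_image
    ((G.splitters x y).filter fun z => G.degree z = G.degree w) (Fintype.equivFin V) ⟨w, by simp [hw]⟩
  rw [Finset.mem_filter] at hz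
  refine Finset.mem_image.mpr ⟨z, Finset.mem_filter.mpr ⟨hz.1, fun t ht hd => ?_⟩, hz.2⟩
  exact hmin t (Finset.mem_filter.mpr ⟨ht, hd.trans hz.2⟩)

/-- The choice uses only the splitters, their degrees and an enumeration of `V` independent of the
graph, all preserved by the switch. -/
theorem degreeReps_symmDiff_twoStar (G : SimpleGraph V) {x y : V} (hxy : x ≠ y) {T : Finset V}
    (hT : T ⊆ G.splitters x y) : (G ∆ twoStar x y T T).degreeReps x y = G.degreeReps x y := by
  have hn := G.notMem_splitters x y
  have hdeg (w : V) (hw : w ∈ G.splitters x y) :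
      (G ∆ twoStar x y T T).degree w = G.degree w :=
    G.degree_symmDiff_twoStar hT (fun h => hn.1 (h ▸ hw)) (fun h => hn.2 (h ▸ hw))
  rw [degreeReps, splitters_symmDiff_twoStar G hxy ⟨fun h => hn.1 (hT h), fun h => hn.2 (hT h)⟩]
  refine Finset.filter_congr fun w hw => ?_
  rw [hdeg w hw]
  exact forall₂_congr fun z hz => by rw [hdeg z hz]

/-- Graphs in which `x` and `y` are degree twins, but whose splitters have many degrees, are
rare. -/
theorem two_pow_mul_card_degreeTwins_le {x y : V} (hxy : x ≠ y) (k : ℕ) :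
    2 ^ k * (Finset.univ.filter fun G : SimpleGraph V =>
      G.DegreeTwins x y ∧ k ≤ (G.degreeReps x y).card).card ≤ Fintype.card (SimpleGraph V) := by
  set E := Finset.univ.filter fun G : SimpleGraph V =>
      G.DegreeTwins x y ∧ k ≤ (G.degreeReps x y).card with hE
  calc 2 ^ k * E.card ≤ ∑ G ∈ E, 2 ^ (G.degreeReps x y).card := by
        rw [mul_comm, ← smul_eq_mul]
        refine Finset.card_nsmul_le_sum _ _ _ fun G hG => ?_
        exact Nat.pow_le_pow_right two_pos (Finset.mem_filter.mp hG).2.2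
    _ = (E.sigma fun G => (G.degreeReps x y).powerset).card := by
        simp [Finset.card_sigma]
    _ ≤ (Finset.univ : Finset (SimpleGraph V)).card := by
        -- If two pairs give the same graph, then `G'` arises from `G` by switching at `T ∆ T'`.
        -- Both have `x`, `y` as twins, so this set must be empty.
        refine Finset.card_le_card_of_injOn (fun p => p.1 ∆ twoStar x y p.2 p.2)
          (fun _ _ => Finset.mem_coe.mpr (Finset.mem_univ _)) ?_
        rintro ⟨G, T⟩ hG ⟨G', T'⟩ hG' heq
        simp only [Finset.coe_sigma, Set.mem_sigma_iff, Finset.mem_coe, hE, Finset.mem_filter,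
          Finset.mem_univ, true_and, Finset.mem_powerset] at hG hG' heq
        have hT := hG.2.trans (G.degreeReps_subset x y)
        have hT' := hG'.2.trans (G'.degreeReps_subset x y)
        have hreps : G.degreeReps x y = G'.degreeReps x y := by
          rw [← degreeReps_symmDiff_twoStar G hxy hT, heq, degreeReps_symmDiff_twoStar G' hxy hT']
        have hn := G.notMem_splitters x y
        have hn' := G'.notMem_splitters x y
        have hTxy : x ∉ T ∧ y ∉ T := ⟨fun h => hn.1 (hT h), fun h => hn.2 (hT h)⟩
        have hTxy' : x ∉ T' ∧ y ∉ T' := ⟨fun h => hn'.1 (hT' h), fun h => hn'.2 (hT' h)⟩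
        have hG'eq : G' = G ∆ twoStar x y (T ∆ T') (T ∆ T') := by
          rw [← twoStar_symmDiff hxy hTxy hTxy hTxy' hTxy', ← symmDiff_assoc, heq,
            symmDiff_symmDiff_cancel_right]
        have hsub : T ∆ T' ⊆ G.degreeReps x y := by
          intro w hw
          rcases Finset.mem_symmDiff.mp hw with hw | hw
          · exact hG.2 hw.1
          · rw [hreps]
            exact hG'.2 hw.1
        have hempty : T ∆ T' = ∅ := by
          by_contra hne
          refine hG.1.1.not_symmDiff_twoStar hxy (hsub.trans (G.degreeReps_subset x y))
            ((G.injOn_degree_degreeReps x y).mono (Finset.coe_subset.mpr hsub))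
            (Finset.nonempty_iff_ne_empty.mpr hne) ?_
          rw [← hG'eq]
          exact hG'.1.1
        have hTT : T = T' := symmDiff_eq_bot.mp hempty
        subst hTT
        have hGG : G = G' := symmDiff_left_injective _ heq
        subst hGG
        rfl
    _ = Fintype.card (SimpleGraph V) := Finset.card_univ

end

end SimpleGraph

/-! ### Exact counts and Cauchy–Schwarz -/

namespace SimpleGraph

noncomputable section

open scoped Classical symmDiff

variable {V : Type*} [Fintype V]

/-- For distinct `x` and `y`, the neighbourhoods of `x` and `y` outside `{x, y}` are independent
and uniformly distributed. -/
theorem card_filter_outerNeighbors_mul {x y : V} (hxy : x ≠ y)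
    (P : Finset V → Finset V → Prop) [∀ X Y, Decidable (P X Y)] :
    (Finset.univ.filter fun G : SimpleGraph V =>
        P (G.outerNeighbors x y) (G.outerNeighbors y x)).card * 4 ^ (Fintype.card V - 2) =
      ((({x, y}ᶜ : Finset V).powerset ×ˢ ({x, y}ᶜ : Finset V).powerset).filter
        fun p => P p.1 p.2).card * Fintype.card (SimpleGraph V) := by
  set S := ({x, y}ᶜ : Finset V).powerset ×ˢ ({x, y}ᶜ : Finset V).powerset with hS
  set f : SimpleGraph V → Finset V × Finset V :=
    fun G => (G.outerNeighbors x y, G.outerNeighbors y x) with hf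
  have memS (p : Finset V × Finset V) :
      p ∈ S ↔ (x ∉ p.1 ∧ y ∉ p.1) ∧ x ∉ p.2 ∧ y ∉ p.2 := by
    simp only [hS, Finset.mem_product, Finset.mem_powerset,
      Finset.subset_compl_iff_disjoint_right, Finset.disjoint_insert_right,
      Finset.disjoint_singleton_right]
  have hfS (G : SimpleGraph V) : f G ∈ S :=
    (memS _).mpr ⟨G.notMem_outerNeighbors x y, (G.notMem_outerNeighbors y x).symm⟩
  have hcard : S.card = 4 ^ (Fintype.card V - 2) := by
    rw [hS, Finset.card_product, Finset.card_powerset, Finset.card_compl, Finset.card_pair hxy,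
      ← mul_pow]
    norm_num
  have hftrans (G : SimpleGraph V) (p : Finset V × Finset V) (hp : p ∈ S) :
      f (G ∆ twoStar x y p.1 p.2) = ((f G).1 ∆ p.1, (f G).2 ∆ p.2) := by
    rw [memS] at hp
    simp only [hf, outerNeighbors_symmDiff_twoStar_left G hxy hp.1 hp.2,
      outerNeighbors_symmDiff_twoStar_right G hxy hp.1 hp.2]
  -- Toggling the two stars given by `p` exchanges the fibre over `p` with that over the empty pair,
  -- so all fibres have equal size.
  have hfiber (p : Finset V × Finset V) (hp : p ∈ S) :
      (Finset.univ.filter fun G => f G = p).card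
        = (Finset.univ.filter fun G => f G = (∅, ∅)).card := by
    refine Finset.card_bij' (fun G _ => G ∆ twoStar x y p.1 p.2)
      (fun G _ => G ∆ twoStar x y p.1 p.2) ?_ ?_ ?_ ?_
    · intro G hG
      have hG' := (Finset.mem_filter.mp hG).2
      refine Finset.mem_filter.mpr ⟨Finset.mem_univ _, ?_⟩
      rw [hftrans G p hp, hG', symmDiff_self, symmDiff_self]
      rfl
    · intro G hG
      have hG' := (Finset.mem_filter.mp hG).2
      refine Finset.mem_filter.mpr ⟨Finset.mem_univ _, ?_⟩
      rw [hftrans G p hp, hG']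
      exact Prod.ext (bot_symmDiff _) (bot_symmDiff _)
    · exact fun G _ => symmDiff_symmDiff_cancel_right _ _
    · exact fun G _ => symmDiff_symmDiff_cancel_right _ _
  have htotal : Fintype.card (SimpleGraph V)
      = S.card * (Finset.univ.filter fun G => f G = (∅, ∅)).card := by
    rw [← Finset.card_univ, Finset.card_eq_sum_card_fiberwise (f := f) (t := S)
      (fun G _ => hfS G), Finset.sum_congr rfl hfiber, Finset.sum_const, smul_eq_mul]
  have hpart : (Finset.univ.filter fun G : SimpleGraph V => P (f G).1 (f G).2).card
      = (S.filter fun p => P p.1 p.2).card *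
        (Finset.univ.filter fun G => f G = (∅, ∅)).card := by
    rw [Finset.card_eq_sum_card_fiberwise (f := f) (t := S.filter fun p => P p.1 p.2)
      (fun G hG => Finset.mem_coe.mpr (Finset.mem_filter.mpr
        ⟨hfS G, (Finset.mem_filter.mp (Finset.mem_coe.mp hG)).2⟩)), ← smul_eq_mul,
      ← Finset.sum_const]
    refine Finset.sum_congr rfl fun p hp => ?_
    rw [Finset.mem_filter] at hp
    rw [← hfiber p hp.1, Finset.filter_filter]
    congr 1
    refine Finset.filter_congr fun G _ => ⟨And.right, fun h => ⟨?_, h⟩⟩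
    rw [h]
    exact hp.2
  rw [htotal, ← hcard]
  change (Finset.univ.filter fun G : SimpleGraph V => P (f G).1 (f G).2).card * _ = _
  rw [hpart]
  ring

/-- Vandermonde's identity for $\sum_k\binom{m}{k}^2$. -/
theorem card_filter_powerset_card_eq {α : Type*} (W : Finset α) :
    ((W.powerset ×ˢ W.powerset).filter fun p => p.1.card = p.2.card).card
      = Nat.centralBinom W.card := by
  rw [Finset.card_filter, Finset.sum_product]
  have h (X : Finset α) : ∑ Y ∈ W.powerset, (if X.card = Y.card then 1 else 0)
      = W.card.choose X.card := by
    rw [← Finset.card_filter, ← Finset.card_powersetCard, Finset.powersetCard_eq_filter]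
    congr 1
    exact Finset.filter_congr fun Y _ => eq_comm
  simp only [h]
  rw [Finset.sum_powerset_apply_card (fun k => W.card.choose k),
    Nat.centralBinom, ← Nat.sum_range_choose_sq]
  exact Finset.sum_congr rfl fun k _ => by rw [smul_eq_mul, sq]

theorem card_filter_degree_eq {x y : V} (hxy : x ≠ y) :
    (Finset.univ.filter fun G : SimpleGraph V => G.degree x = G.degree y).card
        * 4 ^ (Fintype.card V - 2) =
      Nat.centralBinom (Fintype.card V - 2) * Fintype.card (SimpleGraph V) := by
  have h := card_filter_outerNeighbors_mul hxy fun X Y => X.card = Y.card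
  rw [card_filter_powerset_card_eq, Finset.card_compl, Finset.card_pair hxy] at h
  rw [← h]
  congr 2
  refine Finset.filter_congr fun G _ => ?_
  rw [G.degree_eq_card_outerNeighbors x y, G.degree_eq_card_outerNeighbors y x, G.adj_comm y x,
    Nat.add_right_cancel_iff]

/-- An exponential Markov bound: each set counted has weight $2^{s-|Z|}\ge 1$, and the weights are
summed by the binomial theorem. -/
theorem card_filter_powerset_card_lt_mul_le {α : Type*} (W : Finset α) (s : ℕ) :
    (W.powerset.filter fun Z => Z.card < s).card * 2 ^ W.card ≤ 2 ^ s * 3 ^ W.card := by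
  have h := Finset.sum_pow_mul_eq_add_pow (1 : ℕ) 2 W
  simp only [one_pow, one_mul] at h
  calc (W.powerset.filter fun Z => Z.card < s).card * 2 ^ W.card
      = ∑ Z ∈ W.powerset.filter fun Z => Z.card < s, 2 ^ W.card := by
        rw [Finset.sum_const, smul_eq_mul]
    _ ≤ ∑ Z ∈ W.powerset.filter fun Z => Z.card < s, 2 ^ s * 2 ^ (W.card - Z.card) := by
        refine Finset.sum_le_sum fun Z hZ => ?_
        rw [← pow_add]
        refine Nat.pow_le_pow_right two_pos ?_
        have := (Finset.mem_filter.mp hZ).2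
        lia
    _ ≤ ∑ Z ∈ W.powerset, 2 ^ s * 2 ^ (W.card - Z.card) :=
        Finset.sum_le_sum_of_subset (Finset.filter_subset _ _)
    _ = 2 ^ s * 3 ^ W.card := by rw [← Finset.mul_sum, h]

/-- For fixed `X`, the map `Y ↦ X ∆ Y` is a bijection, so the set of splitters is uniformly
distributed. -/
theorem card_filter_splitters_lt_mul_le {x y : V} (hxy : x ≠ y) (s : ℕ) :
    (Finset.univ.filter fun G : SimpleGraph V => (G.splitters x y).card < s).card
        * 4 ^ (Fintype.card V - 2) ≤
      2 ^ s * 3 ^ (Fintype.card V - 2) * Fintype.card (SimpleGraph V) := by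
  have hW : ({x, y}ᶜ : Finset V).card = Fintype.card V - 2 := by
    rw [Finset.card_compl, Finset.card_pair hxy]
  have h := card_filter_outerNeighbors_mul hxy fun X Y => (X ∆ Y).card < s
  have hpairs : ((({x, y}ᶜ : Finset V).powerset ×ˢ ({x, y}ᶜ : Finset V).powerset).filter
        fun p => (p.1 ∆ p.2).card < s).card
      = 2 ^ (Fintype.card V - 2) *
        ((({x, y}ᶜ : Finset V).powerset).filter fun Z => Z.card < s).card := by
    rw [Finset.card_filter, Finset.sum_product, ← hW, ← Finset.card_powerset, ← smul_eq_mul,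
      ← Finset.sum_const]
    refine Finset.sum_congr rfl fun X hX => ?_
    rw [← Finset.card_filter]
    have hsub (Z : Finset V) (hZ : Z ∈ ({x, y}ᶜ : Finset V).powerset) :
        X ∆ Z ∈ ({x, y}ᶜ : Finset V).powerset := by
      rw [Finset.mem_powerset] at hX hZ ⊢
      intro w hw
      rcases Finset.mem_symmDiff.mp hw with hw | hw
      · exact hX hw.1
      · exact hZ hw.1
    refine Finset.card_bij' (fun Y _ => X ∆ Y) (fun Z _ => X ∆ Z) ?_ ?_ ?_ ?_
    · intro Y hY
      rw [Finset.mem_filter] at hY ⊢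
      exact ⟨hsub Y hY.1, hY.2⟩
    · intro Z hZ
      rw [Finset.mem_filter] at hZ ⊢
      exact ⟨hsub Z hZ.1, by rw [symmDiff_symmDiff_cancel_left]; exact hZ.2⟩
    · exact fun Y _ => symmDiff_symmDiff_cancel_left _ _
    · exact fun Y _ => symmDiff_symmDiff_cancel_left _ _
  rw [hpairs] at h
  have h2 := card_filter_powerset_card_lt_mul_le ({x, y}ᶜ : Finset V) s
  rw [hW] at h2
  calc _ = _ := h
    _ ≤ _ := Nat.mul_le_mul_right _ (by rw [mul_comm]; exact h2)

/-- The square of the number of splitters is at most the number of their degrees times the number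
of pairs of vertices of equal degree. -/
theorem card_splitters_sq_le (G : SimpleGraph V) (x y : V) :
    (G.splitters x y).card ^ 2 ≤ (G.degreeReps x y).card *
      (Finset.univ.filter fun p : V × V => G.degree p.1 = G.degree p.2).card := by
  set Z := G.splitters x y
  set I := Z.image fun w => G.degree w
  have hZ : Z.card = ∑ d ∈ I, (Z.filter fun w => G.degree w = d).card :=
    Finset.card_eq_sum_card_image _ _
  calc Z.card ^ 2 ≤ I.card * ∑ d ∈ I, (Z.filter fun w => G.degree w = d).card ^ 2 := by
        rw [hZ]
        exact sq_sum_le_card_mul_sum_sq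
    _ ≤ _ := Nat.mul_le_mul (G.card_image_degree_le x y) ?_
  -- The squares count ordered pairs of splitters within a degree class.
  calc ∑ d ∈ I, (Z.filter fun w => G.degree w = d).card ^ 2
      = (I.sigma fun d => (Z.filter fun w => G.degree w = d) ×ˢ
          (Z.filter fun w => G.degree w = d)).card := by
        simp [Finset.card_sigma, Finset.card_product, sq]
    _ ≤ _ := by
        refine Finset.card_le_card_of_injOn (fun q => q.2) ?_ ?_
        · rintro ⟨d, p⟩ hp
          simp only [Finset.coe_sigma, Set.mem_sigma_iff, Finset.mem_coe, Finset.mem_product,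
            Finset.mem_filter] at hp
          simp [hp.2.1.2, hp.2.2.2]
        · rintro ⟨d, p⟩ hp ⟨e, q⟩ hq heq
          simp only [Finset.coe_sigma, Set.mem_sigma_iff, Finset.mem_coe, Finset.mem_product,
            Finset.mem_filter] at hp hq heq
          subst heq
          have : d = e := hp.2.1.2.symm.trans hq.2.1.2
          rw [this]

end

end SimpleGraph

/-! ### Probability estimates -/

theorem Nat.two_mul_add_one_mul_centralBinom_sq_le (m : ℕ) :
    (2 * m + 1) * m.centralBinom ^ 2 ≤ 16 ^ m := by
  induction m with
  | zero => simp
  | succ m ih =>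
    have h := m.succ_mul_centralBinom_succ
    refine le_of_mul_le_mul_left (a := (m + 1) ^ 2) ?_ (pow_pos m.succ_pos 2)
    calc (m + 1) ^ 2 * ((2 * (m + 1) + 1) * (m + 1).centralBinom ^ 2)
        = (2 * m + 3) * ((m + 1) * (m + 1).centralBinom) ^ 2 := by ring
      _ = 4 * ((2 * m + 1) * (2 * m + 3)) * ((2 * m + 1) * m.centralBinom ^ 2) := by
          rw [h]
          ring
      _ ≤ 4 * (4 * (m + 1) ^ 2) * 16 ^ m := by
          -- This bounds by 16 the ratio of consecutive left-hand sides.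
          have hm : (2 * m + 1) * (2 * m + 3) ≤ 4 * (m + 1) ^ 2 := by nlinarith
          exact Nat.mul_le_mul (Nat.mul_le_mul_left 4 hm) ih
      _ = (m + 1) ^ 2 * 16 ^ (m + 1) := by ring

namespace SimpleGraph

open scoped Classical

variable {V : Type*} [Fintype V]

theorem card_filter_degree_eq_le {x y : V} (hxy : x ≠ y) :
    ((Finset.univ.filter fun G : SimpleGraph V => G.degree x = G.degree y).card : ℝ) ≤
      Fintype.card (SimpleGraph V) / √(2 * (Fintype.card V - 2 : ℕ) + 1) := by
  set m := Fintype.card V - 2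
  have h : ((Finset.univ.filter fun G : SimpleGraph V => G.degree x = G.degree y).card : ℝ)
      * 4 ^ m = m.centralBinom * Fintype.card (SimpleGraph V) :=
    mod_cast card_filter_degree_eq hxy
  have hb : (m.centralBinom : ℝ) * √(2 * m + 1) ≤ 4 ^ m := by
    refine le_of_sq_le_sq ?_ (by positivity)
    rw [mul_pow, Real.sq_sqrt (by positivity), ← pow_mul, mul_comm m 2, pow_mul, mul_comm]
    norm_num
    exact_mod_cast m.two_mul_add_one_mul_centralBinom_sq_le
  rw [le_div_iff₀ (by positivity)]
  refine le_of_mul_le_mul_right ?_ (by positivity : (0 : ℝ) < 4 ^ m)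
  calc _ = (m.centralBinom * √(2 * m + 1)) * (Fintype.card (SimpleGraph V) : ℝ) := by
        rw [mul_right_comm, h]
        ring
    _ ≤ 4 ^ m * (Fintype.card (SimpleGraph V) : ℝ) := by gcongr
    _ = _ := mul_comm _ _

theorem card_filter_degreeTwins_le {x y : V} (hxy : x ≠ y) (k : ℕ) :
    ((Finset.univ.filter fun G : SimpleGraph V =>
      G.DegreeTwins x y ∧ k ≤ (G.degreeReps x y).card).card : ℝ) ≤
      Fintype.card (SimpleGraph V) / 2 ^ k := by
  rw [le_div_iff₀ (by positivity), mul_comm]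
  exact_mod_cast two_pow_mul_card_degreeTwins_le hxy k

theorem card_filter_splitters_lt_le {x y : V} (hxy : x ≠ y) (s : ℕ) :
    ((Finset.univ.filter fun G : SimpleGraph V => (G.splitters x y).card < s).card : ℝ) ≤
      2 ^ s * (3 / 4) ^ (Fintype.card V - 2) * Fintype.card (SimpleGraph V) := by
  have h : ((Finset.univ.filter fun G : SimpleGraph V => (G.splitters x y).card < s).card : ℝ)
        * 4 ^ (Fintype.card V - 2) ≤
      2 ^ s * 3 ^ (Fintype.card V - 2) * Fintype.card (SimpleGraph V) :=
    mod_cast card_filter_splitters_lt_mul_le hxy s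
  rw [div_pow, mul_div_assoc', div_mul_eq_mul_div, le_div_iff₀ (by positivity)]
  exact h

/-- Linearity of expectation: diagonal pairs always count, which gives the linear term. -/
theorem sum_card_degree_eq_le :
    ∑ G : SimpleGraph V,
        ((Finset.univ.filter fun p : V × V => G.degree p.1 = G.degree p.2).card : ℝ) ≤
      (Fintype.card V + Fintype.card V ^ 2 / √(2 * (Fintype.card V - 2 : ℕ) + 1)) *
        Fintype.card (SimpleGraph V) := by
  set N := (Fintype.card (SimpleGraph V) : ℝ)
  set c : ℝ := √(2 * (Fintype.card V - 2 : ℕ) + 1)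
  have hc : 0 ≤ N / c := by positivity
  have hswap : ∑ G : SimpleGraph V,
        ((Finset.univ.filter fun p : V × V => G.degree p.1 = G.degree p.2).card : ℝ)
      = ∑ x : V, ∑ y : V,
        ((Finset.univ.filter fun G : SimpleGraph V => G.degree x = G.degree y).card : ℝ) := by
    simp only [Finset.card_filter, Nat.cast_sum]
    rw [Finset.sum_comm, Fintype.sum_prod_type]
  rw [hswap]
  calc ∑ x : V, ∑ y : V,
        ((Finset.univ.filter fun G : SimpleGraph V => G.degree x = G.degree y).card : ℝ)
      ≤ ∑ x : V, ∑ y : V, ((if x = y then N else 0) + N / c) := by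
        refine Finset.sum_le_sum fun x _ => Finset.sum_le_sum fun y _ => ?_
        split_ifs with hxy
        · refine le_add_of_le_of_nonneg ?_ hc
          exact Nat.cast_le.mpr (Finset.card_le_univ _)
        · rw [zero_add]
          exact card_filter_degree_eq_le hxy
    _ = (Fintype.card V + Fintype.card V ^ 2 / c) * N := by
        simp [Finset.sum_add_distrib]
        ring

/-- Markov's inequality for the number of pairs of equal degree. -/
theorem card_filter_le_mul_pairs_le (s k : ℕ) (hs : 0 < s) :
    ((Finset.univ.filter fun G : SimpleGraph V => s ^ 2 ≤
      k * (Finset.univ.filter fun p : V × V => G.degree p.1 = G.degree p.2).card).card : ℝ) ≤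
      k * (Fintype.card V + Fintype.card V ^ 2 / √(2 * (Fintype.card V - 2 : ℕ) + 1)) / s ^ 2 *
        Fintype.card (SimpleGraph V) := by
  rw [div_mul_eq_mul_div, le_div_iff₀ (by positivity), mul_assoc]
  refine le_trans ?_ (mul_le_mul_of_nonneg_left sum_card_degree_eq_le k.cast_nonneg)
  rw [← nsmul_eq_mul, Finset.mul_sum]
  refine (Finset.card_nsmul_le_sum _ (fun G : SimpleGraph V => (k : ℝ) *
    (Finset.univ.filter fun p : V × V => G.degree p.1 = G.degree p.2).card) _
    fun G hG => ?_).trans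
    (Finset.sum_le_sum_of_subset_of_nonneg (Finset.filter_subset _ _) fun _ _ _ => by positivity)
  exact_mod_cast (Finset.mem_filter.mp hG).2

/-- The proportion of graphs having a pair of degree twins. -/
theorem card_filter_exists_degreeTwins_le (s k : ℕ) (hs : 0 < s) :
    ((Finset.univ.filter fun G : SimpleGraph V => ∃ x y, x ≠ y ∧ G.DegreeTwins x y).card : ℝ) ≤
      (Fintype.card V ^ 2 / 2 ^ k + Fintype.card V ^ 2 * (2 ^ s * (3 / 4) ^ (Fintype.card V - 2)) +
        k * (Fintype.card V + Fintype.card V ^ 2 / √(2 * (Fintype.card V - 2 : ℕ) + 1)) / s ^ 2) *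
        Fintype.card (SimpleGraph V) := by
  set N := (Fintype.card (SimpleGraph V) : ℝ)
  set P := (Finset.univ : Finset V).offDiag
  have hP : (P.card : ℝ) ≤ Fintype.card V ^ 2 := by
    have : P.card ≤ Fintype.card V ^ 2 := by
      rw [Finset.offDiag_card, Finset.card_univ, sq]
      exact Nat.sub_le _ _
    exact_mod_cast this
  set E₁ := fun p : V × V => Finset.univ.filter fun G : SimpleGraph V =>
      G.DegreeTwins p.1 p.2 ∧ k ≤ (G.degreeReps p.1 p.2).card
  set E₂ := fun p : V × V => Finset.univ.filter fun G : SimpleGraph V =>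
      (G.splitters p.1 p.2).card < s
  set E₃ := Finset.univ.filter fun G : SimpleGraph V => s ^ 2 ≤
      k * (Finset.univ.filter fun p : V × V => G.degree p.1 = G.degree p.2).card
  -- For a pair of twins, either the representatives are many, or the splitters are few, or
  -- Cauchy–Schwarz forces many pairs of equal degree.
  have hsub : (Finset.univ.filter fun G : SimpleGraph V => ∃ x y, x ≠ y ∧ G.DegreeTwins x y) ⊆
      (P.biUnion E₁ ∪ P.biUnion E₂) ∪ E₃ := by
    intro G hG
    obtain ⟨x, y, hxy, htwins⟩ := (Finset.mem_filter.mp hG).2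
    have hp : (x, y) ∈ P := by simpa [P] using hxy
    simp only [Finset.mem_union, Finset.mem_biUnion]
    by_cases h₁ : k ≤ (G.degreeReps x y).card
    · exact .inl (.inl ⟨_, hp, Finset.mem_filter.mpr ⟨Finset.mem_univ _, htwins, h₁⟩⟩)
    by_cases h₂ : (G.splitters x y).card < s
    · exact .inl (.inr ⟨_, hp, Finset.mem_filter.mpr ⟨Finset.mem_univ _, h₂⟩⟩)
    push Not at h₁ h₂
    refine .inr (Finset.mem_filter.mpr ⟨Finset.mem_univ _, ?_⟩)
    calc s ^ 2 ≤ (G.splitters x y).card ^ 2 := Nat.pow_le_pow_left h₂ 2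
      _ ≤ _ := G.card_splitters_sq_le x y
      _ ≤ _ := Nat.mul_le_mul_right _ h₁.le
  have h₁ : ((P.biUnion E₁).card : ℝ) ≤ Fintype.card V ^ 2 * (N / 2 ^ k) := by
    calc ((P.biUnion E₁).card : ℝ) ≤ ∑ p ∈ P, ((E₁ p).card : ℝ) := mod_cast Finset.card_biUnion_le
      _ ≤ P.card • (N / 2 ^ k) := Finset.sum_le_card_nsmul _ _ _ fun p hp =>
          card_filter_degreeTwins_le (Finset.mem_offDiag.mp hp).2.2 k
      _ ≤ _ := by
          rw [nsmul_eq_mul]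
          gcongr
  have h₂ : ((P.biUnion E₂).card : ℝ) ≤
      Fintype.card V ^ 2 * (2 ^ s * (3 / 4) ^ (Fintype.card V - 2) * N) := by
    calc ((P.biUnion E₂).card : ℝ) ≤ ∑ p ∈ P, ((E₂ p).card : ℝ) := mod_cast Finset.card_biUnion_le
      _ ≤ P.card • (2 ^ s * (3 / 4) ^ (Fintype.card V - 2) * N) :=
          Finset.sum_le_card_nsmul _ _ _ fun p hp =>
            card_filter_splitters_lt_le (Finset.mem_offDiag.mp hp).2.2 s
      _ ≤ _ := by
          rw [nsmul_eq_mul]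
          gcongr
  have h₃ : (E₃.card : ℝ) ≤ _ := card_filter_le_mul_pairs_le s k hs
  have hcard := (Finset.card_le_card hsub).trans ((Finset.card_union_le _ _).trans
    (Nat.add_le_add_right (Finset.card_union_le _ _) _))
  have hcard' : ((Finset.univ.filter fun G : SimpleGraph V =>
      ∃ x y, x ≠ y ∧ G.DegreeTwins x y).card : ℝ) ≤
      (P.biUnion E₁).card + (P.biUnion E₂).card + E₃.card := mod_cast hcard
  refine (hcard'.trans (add_le_add (add_le_add h₁ h₂) h₃)).trans (le_of_eq ?_)
  ring

end SimpleGraph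

/-! ### Choice of parameters and the limit -/

theorem Nat.tendsto_sqrt_atTop : Tendsto Nat.sqrt atTop atTop :=
  tendsto_atTop_atTop.mpr fun b => ⟨b * b, fun _ ha => Nat.le_sqrt.mpr ha⟩

/-- Each term is bounded through `k ≈ n^(1/4)` or `s = n / 10` alone, using `k ^ 4 ≤ n ≤ (k + 1) ^
4` and `n ≤ 10 * (s + 1)`, so that standard limits apply. -/
theorem twins_bound_le {n : ℕ} (hn : 20 ≤ n) :
    (n ^ 2 / 2 ^ n.sqrt.sqrt + n ^ 2 * (2 ^ (n / 10) * (3 / 4) ^ (n - 2)) +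
      n.sqrt.sqrt * (n + n ^ 2 / √(2 * (n - 2 : ℕ) + 1)) / (n / 10 : ℕ) ^ 2 : ℝ) ≤
    2 * ((n.sqrt.sqrt + 1 : ℕ) ^ 8 / 2 ^ (n.sqrt.sqrt + 1)) +
      1600 * ((n / 10 + 1 : ℕ) ^ 2 / 8 ^ (n / 10 + 1)) + 800 / n.sqrt.sqrt := by
  set k := n.sqrt.sqrt with hk
  set s := n / 10 with hs
  have hkpos : 0 < k := Nat.sqrt_pos.mpr (Nat.sqrt_pos.mpr (by lia))
  have hkn : k ^ 4 ≤ n := by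
    have h1 := Nat.sqrt_le' n
    have h2 := Nat.sqrt_le' n.sqrt
    calc k ^ 4 = (k ^ 2) ^ 2 := by ring
      _ ≤ n.sqrt ^ 2 := Nat.pow_le_pow_left h2 2
      _ ≤ n := h1
  have hnk : n ≤ (k + 1) ^ 4 := by
    have h1 := Nat.lt_succ_sqrt' n
    have h2 := Nat.lt_succ_sqrt' n.sqrt
    calc n ≤ (n.sqrt + 1) ^ 2 := h1.le
      _ ≤ ((k + 1) ^ 2) ^ 2 := Nat.pow_le_pow_left h2 2
      _ = (k + 1) ^ 4 := by ring
  have hnpos : (0 : ℝ) < n := by exact_mod_cast (by lia : 0 < n)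
  have hk0 : (0 : ℝ) < k := by exact_mod_cast hkpos
  refine add_le_add (add_le_add ?_ ?_) ?_
  · rw [pow_succ (2 : ℝ) k]
    have : (n : ℝ) ^ 2 ≤ (k + 1 : ℕ) ^ 8 := by
      calc (n : ℝ) ^ 2 ≤ (((k + 1) ^ 4 : ℕ) : ℝ) ^ 2 := by gcongr
        _ = _ := by push_cast; ring
    calc (n : ℝ) ^ 2 / 2 ^ k ≤ (k + 1 : ℕ) ^ 8 / 2 ^ k := by gcongr
      _ = _ := by field_simp
  · have h1 : (n : ℝ) ≤ 10 * ((s + 1 : ℕ) : ℝ) := by exact_mod_cast (by lia : n ≤ 10 * (s + 1))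
    -- The factor 2 absorbs $(4/3)^2=16/9$.
    have h2 : ((3 : ℝ) / 4) ^ (n - 2) ≤ 2 * (3 / 4) ^ (10 * s) := by
      have h : ((3 : ℝ) / 4) ^ n ≤ (3 / 4) ^ (10 * s) :=
        pow_le_pow_of_le_one (by norm_num) (by norm_num) (by lia)
      have h' : ((3 : ℝ) / 4) ^ n = (3 / 4) ^ (n - 2) * (9 / 16) := by
        conv_lhs => rw [← Nat.sub_add_cancel (by lia : 2 ≤ n), pow_add]
        norm_num
      have h0 : (0 : ℝ) ≤ (3 / 4) ^ (n - 2) := by positivity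
      rw [h'] at h
      linarith
    -- The divisor 10 is large enough that $2\,(3/4)^{10}\le 1/8$.
    have h3 : (2 : ℝ) ^ s * (3 / 4) ^ (10 * s) ≤ (1 / 8) ^ s := by
      rw [pow_mul, ← mul_pow]
      exact pow_le_pow_left₀ (by norm_num) (by norm_num) s
    calc (n : ℝ) ^ 2 * (2 ^ s * (3 / 4) ^ (n - 2) : ℝ)
        ≤ (10 * ((s + 1 : ℕ) : ℝ)) ^ 2 * (2 ^ s * (2 * (3 / 4) ^ (10 * s))) := by gcongr
      _ = 200 * ((s + 1 : ℕ) : ℝ) ^ 2 * (2 ^ s * (3 / 4) ^ (10 * s)) := by ring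
      _ ≤ 200 * ((s + 1 : ℕ) : ℝ) ^ 2 * (1 / 8) ^ s := by gcongr
      _ = _ := by
          rw [pow_succ (8 : ℝ) s, one_div, inv_pow]
          field_simp
          norm_num
  · have hsn : (n : ℝ) / 20 ≤ s := by
      rw [div_le_iff₀ (by norm_num)]
      exact_mod_cast (by lia : n ≤ s * 20)
    have hk2 : (k : ℝ) ^ 2 ≤ √n := by
      refine Real.le_sqrt_of_sq_le ?_
      rw [← pow_mul]
      exact_mod_cast hkn
    have hroot : (k : ℝ) ^ 2 ≤ √(2 * (n - 2 : ℕ) + 1) :=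
      hk2.trans (Real.sqrt_le_sqrt (by exact_mod_cast (by lia : n ≤ 2 * (n - 2) + 1)))
    have hk2n : (k : ℝ) ^ 2 ≤ n := by
      have h : k ^ 2 ≤ n := (Nat.pow_le_pow_right hkpos (by norm_num)).trans hkn
      exact_mod_cast h
    have hlin : (n : ℝ) ≤ n ^ 2 / k ^ 2 := by
      rw [le_div_iff₀ (by positivity), sq (n : ℝ)]
      gcongr
    calc (k : ℝ) * (n + n ^ 2 / √(2 * (n - 2 : ℕ) + 1)) / (s : ℝ) ^ 2
        ≤ (k : ℝ) * (n ^ 2 / k ^ 2 + n ^ 2 / k ^ 2) / ((n : ℝ) / 20) ^ 2 := by gcongr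
      _ = 800 / (k : ℝ) := by
          field_simp
          norm_num

theorem tendsto_twins_bound :
    Tendsto (fun n : ℕ => (n ^ 2 / 2 ^ n.sqrt.sqrt + n ^ 2 * (2 ^ (n / 10) * (3 / 4) ^ (n - 2)) +
      n.sqrt.sqrt * (n + n ^ 2 / √(2 * (n - 2 : ℕ) + 1)) / (n / 10 : ℕ) ^ 2 : ℝ))
      atTop (𝓝 0) := by
  have hk : Tendsto (fun n : ℕ => n.sqrt.sqrt) atTop atTop :=
    Nat.tendsto_sqrt_atTop.comp Nat.tendsto_sqrt_atTop
  have hs : Tendsto (fun n : ℕ => n / 10) atTop atTop :=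
    tendsto_atTop_atTop.mpr fun b => ⟨b * 10, fun a ha => by lia⟩
  have h₁ := (tendsto_pow_const_div_const_pow_of_one_lt 8 (one_lt_two (α := ℝ))).comp
    ((tendsto_add_atTop_nat 1).comp hk)
  have h₂ := (tendsto_pow_const_div_const_pow_of_one_lt 2 (by norm_num : (1 : ℝ) < 8)).comp
    ((tendsto_add_atTop_nat 1).comp hs)
  have h₃ := (tendsto_const_div_atTop_nhds_zero_nat (800 : ℝ)).comp hk
  have h := ((h₁.const_mul 2).add (h₂.const_mul 1600)).add h₃
  simp only [mul_zero, add_zero] at h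
  refine squeeze_zero' (.of_forall fun n => by positivity) ?_ h
  filter_upwards [eventually_ge_atTop 20] with n hn
  exact twins_bound_le hn

theorem PMF.toOuterMeasure_uniformOfFintype_eq_ofReal {α : Type*} [Fintype α] [Nonempty α]
    (s : Set α) : (PMF.uniformOfFintype α).toOuterMeasure s =
      ENNReal.ofReal (Nat.card s / Nat.card α) := by
  classical
  rw [PMF.toOuterMeasure_uniformOfFintype_apply, Nat.card_eq_fintype_card,
    Nat.card_eq_fintype_card, ENNReal.ofReal_div_of_pos (by exact_mod_cast Fintype.card_pos),
    ENNReal.ofReal_natCast, ENNReal.ofReal_natCast]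

theorem SimpleGraph.natCard_degreeTwins_div_le {V : Type*} [Fintype V] (s k : ℕ) (hs : 0 < s) :
    (Nat.card {G : SimpleGraph V | ∃ x y, x ≠ y ∧ G.DegreeTwins x y} / Nat.card (SimpleGraph V) : ℝ)
      ≤ Fintype.card V ^ 2 / 2 ^ k +
        Fintype.card V ^ 2 * (2 ^ s * (3 / 4) ^ (Fintype.card V - 2)) +
        k * (Fintype.card V + Fintype.card V ^ 2 / √(2 * (Fintype.card V - 2 : ℕ) + 1)) / s ^ 2 := by
  classical
  have h := card_filter_exists_degreeTwins_le (V := V) s k hs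
  rw [← Nat.card_eq_fintype_card (α := SimpleGraph V)] at h
  rw [div_le_iff₀ (by exact_mod_cast Nat.card_pos), Nat.card_eq_fintype_card (α := Set.Elem _),
    Set.fintypeCard_eq_ncard, Set.ncard_eq_toFinset_card', Set.toFinset_ofPred]
  convert h

theorem theorem3p11 :
    Tendsto
      (fun n : ℕ => (PMF.uniformOfFintype (SimpleGraph (Fin n))).toOuterMeasure
        {G | ¬ HasTrivialQut.{u} G})
      atTop (𝓝 0) := by
  have hbound := ENNReal.tendsto_ofReal tendsto_twins_bound
  rw [ENNReal.ofReal_zero] at hbound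
  refine tendsto_of_tendsto_of_tendsto_of_le_of_le' tendsto_const_nhds hbound
    (.of_forall fun _ => zero_le) ?_
  filter_upwards [eventually_ge_atTop 20] with n hn
  have hsub : {G : SimpleGraph (Fin n) | ¬ HasTrivialQut.{u} G} ⊆
      {G | ∃ x y, x ≠ y ∧ G.DegreeTwins x y} := by
    intro G hG
    by_contra hE
    exact hG (hasTrivialQut_of_no_degreeTwins G fun x y hxy h => hE ⟨x, y, hxy, h⟩)
  refine (MeasureTheory.measure_mono hsub).trans ?_
  rw [PMF.toOuterMeasure_uniformOfFintype_eq_ofReal]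
  have hE := SimpleGraph.natCard_degreeTwins_div_le (V := Fin n) (n / 10) n.sqrt.sqrt (by lia)
  rw [Fintype.card_fin] at hE
  exact ENNReal.ofReal_le_ofReal hE
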